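/- All graphs are finite simple graphs with at least one vertex. For graphs $G=(V_G,E_G)$ and $H=(V_H,E_H)$, the lexicographical product $G[H]$ is the graph on $V_G\times V_H$ in which $(w,x)$ and $(y,z)$ are adjacent if $\{w,y\}\in E_G$, or if $w=y$ and $\{x,z\}\in E_H$. The independence complex $\mathrm{Ind}(G)$ is the simplicial complex on $V_G$ whose faces are the independent sets of $G$ (including $\emptyset$). $K_m$ denotes the complete graph on $m$ vertices, and $H=K_m$ means that $H$ is isomorphic to $K_m$. A simplicial complex is pure if all its facets (maximal faces) have the same dimension. For a face $F$ of $\Delta$ let $\mathrm{del}_\Delta(F)=\{E\in\Delta : F\not\subseteq E\}$ and $\mathrm{link}_\Delta(F)=\{E\in\Delta : F\cap E=\emptyset,\ F\cup E\in\Delta\}$. A complex $\Delta$ is shellable if it is pure and its facets can be ordered $F_1,\dots,F_s$ (each occurring exactly once) so that for all $1\le j<i\le s$ there are $x\in F_i\setminus F_j$ and $k\in\{1,\dots,i-1\}$ with $F_i\setminus F_k=\{x\}$. A complex $\Delta$ is vertex decomposable if it is pure and either it has a unique facet, or it has a vertex $x$ such that $\mathrm{del}_\Delta(\{x\})$ and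 $\mathrm{link}_\Delta(\{x\})$ are both vertex decomposable (recursively, so in particular both are pure). **Theorem.** Let $G$ and $H$ be finite simple graphs, each with at least one vertex. (a) Suppose that $G$ is a graph of isolated vertices, i.e. has no edge. Then $\mathrm{Ind}(H)$ is vertex decomposable if and only if $\mathrm{Ind}(G[H])$ is vertex decomposable, and $\mathrm{Ind}(H)$ is shellable if and only if $\mathrm{Ind}(G[H])$ is shellable. (b) Suppose that $G$ has at least one edge. Then $\mathrm{Ind}(G[H])$ is vertex decomposable if and only if $\mathrm{Ind}(G)$ is vertex decomposable and $H=K_m$ for some $m\ge 1$. (c) Suppose that $G$ has at least one edge. If $\mathrm{Ind}(G)$ is shellable and $H=K_m$ for some $m$, then $\mathrm{Ind}(G[H])$ is shellable. Furthermore, if $\mathrm{Ind}(G[H])$ is shellable, then $H=K_m$ for some $m\ge 1$. -/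

import Mathlib

/-- A family of finite subsets (faces) of `V` that is closed under taking subsets.
Unlike in Mathlib's `AbstractSimplicialComplex`, the empty set is a face (of every complex other
than the void one), and the vertices are those `x : V` for which `{x}` is a face, so that a
deletion or a link is again a complex over the same type, on a smaller vertex set. -/
@[ext]
structure FaceComplex (V : Type*) where
  faces : Set (Finset V)
  down_closed : ∀ {F E : Finset V}, F ∈ faces → E ⊆ F → E ∈ faces

namespace FaceComplex

/-- The facets are the inclusion-maximal faces. -/
def IsFacet {V : Type*} (K : FaceComplex V) (F : Finset V) : Prop :=
  Maximal (fun E => E ∈ K.faces) F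

/-- All facets have the same dimension. -/
def IsPure {V : Type*} (K : FaceComplex V) : Prop :=
  ∀ F E : Finset V, K.IsFacet F → K.IsFacet E → F.card = E.card

/-- A simplex is a complex with a unique facet. -/
def IsSimplex {V : Type*} (K : FaceComplex V) : Prop :=
  ∃! F : Finset V, K.IsFacet F

/-- The deletion of `F`: the faces that do not contain `F`. -/
def del {V : Type*} (K : FaceComplex V) (F : Finset V) : FaceComplex V where
  faces := {E | E ∈ K.faces ∧ ¬ F ⊆ E}
  down_closed := fun h hs => ⟨K.down_closed h.1 hs, fun hF => h.2 (hF.trans hs)⟩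

/-- The link of `F`: the faces disjoint from `F` whose union with `F` is a face. -/
def link {V : Type*} [DecidableEq V] (K : FaceComplex V) (F : Finset V) : FaceComplex V where
  faces := {E | E ∈ K.faces ∧ F ∩ E = ∅ ∧ F ∪ E ∈ K.faces}
  down_closed := fun h hs =>
    ⟨K.down_closed h.1 hs,
      Finset.subset_empty.mp (h.2.1 ▸ Finset.inter_subset_inter_left hs),
      K.down_closed h.2.2 (Finset.union_subset_union_right hs)⟩

/-- A complex is shellable if it is pure and there is an ordering `F 0, …, F (s - 1)` of its facets
(each listed exactly once) such that for all `j < i` there are `x ∈ F i \ F j` and `k < i` with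
`F i \ F k = {x}`. -/
def Shellable {V : Type*} [DecidableEq V] (K : FaceComplex V) : Prop :=
  K.IsPure ∧ ∃ (s : ℕ) (F : Fin s → Finset V),
    Function.Injective F ∧ Set.range F = {E | K.IsFacet E} ∧
      ∀ i j : Fin s, j < i → ∃ x ∈ F i \ F j, ∃ k : Fin s, k < i ∧ F i \ F k = {x}

/-- A pure complex is vertex decomposable if it is a simplex, or it has a vertex whose deletion and
link are vertex decomposable (in particular, pure). -/
inductive VertexDecomposable {V : Type*} [DecidableEq V] : FaceComplex V → Prop
  | simplex (K : FaceComplex V) (hpure : K.IsPure) (hK : K.IsSimplex) : VertexDecomposable K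
  | shed (K : FaceComplex V) (hpure : K.IsPure) (x : V) (hx : {x} ∈ K.faces)
      (hdel : VertexDecomposable (K.del {x})) (hlink : VertexDecomposable (K.link {x})) :
      VertexDecomposable K

end FaceComplex

/-- The independence complex of a graph: its faces are the independent sets. -/
def indComplex {V : Type*} (G : SimpleGraph V) : FaceComplex V where
  faces := {F | G.IsIndepSet (F : Set V)}
  down_closed := fun h hs => Set.Pairwise.mono (Finset.coe_subset.mpr hs) h

/-- The lexicographical product `G[H]`. -/
def lexProduct {V W : Type*} (G : SimpleGraph V) (H : SimpleGraph W) : SimpleGraph (V × W) where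
  Adj p q := G.Adj p.1 q.1 ∨ (p.1 = q.1 ∧ H.Adj p.2 q.2)
  symm := ⟨fun _ _ h => h.elim (fun h => Or.inl h.symm) (fun h => Or.inr ⟨h.1.symm, h.2.symm⟩)⟩
  loopless := ⟨fun _ h => h.elim (fun h => h.ne rfl) (fun h => h.2.ne rfl)⟩

/-! If `G` has no edge, `Ind(G[H])` is the join of copies of `Ind(H)`, one per vertex of `G`. Vertex
decomposability and shellability pass from all factors of a join to the join, and from the join to
each factor (the four lemmas on `fiberJoin`).

If `G` has an edge, both properties imply purity and connectedness of the facets through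
codimension-one steps, which already force `H` to be complete (`eq_top_of_facetConnected`). Were `H`
not complete, purity would make every nonempty fibre of a facet have at least two elements. A step
that loses one element then keeps the projection to `G`, while an edge of `G` yields facets with
different projections.

For `H` complete, a fibre is a clique, so `Ind(G[H])` is `Ind(G)` with each vertex replaced by
interchangeable copies, of which a face uses at most one (`blowup`). Copies are shed one at a time:
until the last copy goes, deletion gives a smaller blowup of the same complex. Hence blowups over
arbitrary finite sets `S` are needed, and vertex decomposability transfers both ways. A shelling
lifts by comparing projections first and chosen copies second. -/

namespace FaceComplex

/-! ### Facets, deletions, links, and shellings as rank functions -/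

section General
variable {V : Type*} {K : FaceComplex V}

lemma exists_isFacet_superset [Finite V] {F : Finset V} (hF : F ∈ K.faces) :
    ∃ E, K.IsFacet E ∧ F ⊆ E := by
  obtain ⟨E, hFE, hE⟩ := (Set.toFinite K.faces).exists_le_maximal hF
  exact ⟨E, hE, hFE⟩

lemma isFacet_iff {F : Finset V} :
    K.IsFacet F ↔ F ∈ K.faces ∧ ∀ E ∈ K.faces, F ⊆ E → E ⊆ F :=
  ⟨fun h => ⟨h.1, fun _ hE hFE => h.2 hE hFE⟩, fun h => ⟨h.1, fun _ hE hFE => h.2 _ hE hFE⟩⟩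

lemma IsFacet.eq_of_subset {F E : Finset V} (hF : K.IsFacet F) (hE : E ∈ K.faces) (h : F ⊆ E) :
    F = E :=
  Finset.Subset.antisymm h (hF.2 hE h)

/-- A simplex has no facet other than its largest face, which contains all the others. -/
lemma IsSimplex.exists_faces_eq [Finite V] (h : K.IsSimplex) :
    ∃ F, K.faces = {E | E ⊆ F} := by
  obtain ⟨F, hF, huniq⟩ := h
  refine ⟨F, Set.ext fun E => ⟨fun hE => ?_, fun hE => K.down_closed hF.1 hE⟩⟩
  obtain ⟨E', hE', hEE'⟩ := exists_isFacet_superset hE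
  exact huniq E' hE' ▸ hEE'

lemma isSimplex_of_faces_eq {F : Finset V} (h : K.faces = {E | E ⊆ F}) : K.IsSimplex := by
  refine ⟨F, isFacet_iff.2 ⟨by simp [h], fun E hE _ => by simpa [h] using hE⟩, fun E hE => ?_⟩
  have : E ⊆ F := by simpa [h] using hE.1
  exact hE.eq_of_subset (by simp [h]) this

lemma IsSimplex.isPure (h : K.IsSimplex) : K.IsPure :=
  fun _ _ hF hE => congrArg _ (h.unique hF hE)

@[simp]
lemma mem_del_singleton {E : Finset V} {x : V} : E ∈ (K.del {x}).faces ↔ E ∈ K.faces ∧ x ∉ E := by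
  simp [del]

lemma isFacet_del_of_isFacet {F : Finset V} {x : V} (hF : K.IsFacet F) (hx : x ∉ F) :
    (K.del {x}).IsFacet F :=
  isFacet_iff.2 ⟨mem_del_singleton.2 ⟨hF.1, hx⟩, fun _ hE h => hF.2 (mem_del_singleton.1 hE).1 h⟩

variable [DecidableEq V]

@[simp]
lemma mem_link_singleton {E : Finset V} {x : V} :
    E ∈ (K.link {x}).faces ↔ x ∉ E ∧ insert x E ∈ K.faces := by
  change E ∈ K.faces ∧ {x} ∩ E = ∅ ∧ {x} ∪ E ∈ K.faces ↔ _
  rw [← Finset.disjoint_iff_inter_eq_empty, Finset.disjoint_singleton_left, ← Finset.insert_eq]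
  exact ⟨And.right, fun h => ⟨K.down_closed h.2 (Finset.subset_insert _ _), h⟩⟩

lemma empty_mem_link {x : V} (hx : {x} ∈ K.faces) : ∅ ∈ (K.link {x}).faces := by
  simpa using hx

lemma isFacet_link_singleton {F : Finset V} {x : V} :
    (K.link {x}).IsFacet F ↔ x ∉ F ∧ K.IsFacet (insert x F) := by
  simp only [isFacet_iff, mem_link_singleton]
  constructor
  · rintro ⟨⟨h1, h2⟩, h3⟩
    refine ⟨h1, h2, fun E hE hFE => ?_⟩
    have hx : x ∈ E := hFE (Finset.mem_insert_self _ _)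
    have := h3 (E.erase x) ⟨by simp, by rwa [Finset.insert_erase hx]⟩
      (fun y hy => Finset.mem_erase.2 ⟨fun h => h1 (h ▸ hy), hFE (Finset.mem_insert_of_mem hy)⟩)
    rw [← Finset.insert_erase hx]
    exact Finset.insert_subset_insert _ this
  · rintro ⟨h1, h2, h3⟩
    refine ⟨⟨h1, h2⟩, fun E hE hFE y hy => ?_⟩
    have := h3 _ hE.2 (Finset.insert_subset_insert _ hFE) (Finset.mem_insert_of_mem hy)
    exact (Finset.mem_insert.1 this).resolve_left fun h => hE.1 (h ▸ hy)

/-- A shelling gives a rank function on the facets. -/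
lemma Shellable.exists_rank (h : K.Shellable) :
    ∃ r : Finset V → ℕ, (∀ A B, K.IsFacet A → K.IsFacet B → r A = r B → A = B) ∧
      ∀ A B, K.IsFacet A → K.IsFacet B → r B < r A →
        ∃ x ∈ A \ B, ∃ C, K.IsFacet C ∧ r C < r A ∧ A \ C = {x} := by
  obtain ⟨-, s, F, hinj, hrange, hF⟩ := h
  have hr : ∀ A, ∃ n : ℕ, ∀ i, F i = A → n = i := by
    intro A
    by_cases hA : ∃ i, F i = A
    · obtain ⟨i, rfl⟩ := hA
      exact ⟨i, fun j hj => congrArg _ (hinj hj).symm⟩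
    -- A set outside the shelling gets the junk rank 0; only ranks of facets matter.
    · exact ⟨0, fun i hi => absurd ⟨i, hi⟩ hA⟩
  choose r hr using hr
  have hr' : ∀ i, r (F i) = i := fun i => hr _ i rfl
  have hex : ∀ A, K.IsFacet A → ∃ i, F i = A := fun A hA => by
    have : A ∈ Set.range F := hrange ▸ hA
    exact this
  have hfac : ∀ i, K.IsFacet (F i) := fun i => by
    have : F i ∈ {E | K.IsFacet E} := hrange ▸ Set.mem_range_self i
    exact this
  refine ⟨r, fun A B hA hB hAB => ?_, fun A B hA hB hAB => ?_⟩ <;>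
    obtain ⟨i, rfl⟩ := hex A hA <;> obtain ⟨j, rfl⟩ := hex B hB <;> rw [hr', hr'] at hAB
  · rw [Fin.ext hAB]
  · obtain ⟨x, hx, k, hk, hxk⟩ := hF i j hAB
    exact ⟨x, hx, F k, hfac k, by rw [hr', hr']; exact hk, hxk⟩

/-- Facets can be sorted into a shelling by a rank function, however ties are broken. -/
lemma shellable_of_rank [Finite V] {α : Type*} [LinearOrder α] (hK : K.IsPure) (r : Finset V → α)
    (hr : ∀ A B, K.IsFacet A → K.IsFacet B → A ≠ B → r B ≤ r A →
      ∃ x ∈ A \ B, ∃ C, K.IsFacet C ∧ r C < r A ∧ A \ C = {x}) :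
    K.Shellable := by
  obtain ⟨s, ⟨e⟩⟩ := Finite.exists_equiv_fin {E // K.IsFacet E}
  set f : Fin s → α := fun i => r (e.symm i).1 with hf
  set σ := Tuple.sort f
  have hmono : Monotone (f ∘ σ) := Tuple.monotone_sort f
  refine ⟨hK, s, fun i => (e.symm (σ i)).1, fun i j hij => ?_, ?_, fun i j hij => ?_⟩
  · exact σ.injective (e.symm.injective (Subtype.ext hij))
  · ext E
    constructor
    · rintro ⟨i, rfl⟩
      exact (e.symm (σ i)).2
    · intro hE
      exact ⟨σ.symm (e ⟨E, hE⟩), by simp⟩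
  · obtain ⟨x, hx, C, hC, hlt, hAC⟩ := hr _ _ (e.symm (σ i)).2 (e.symm (σ j)).2
      (fun h => hij.ne' (σ.injective (e.symm.injective (Subtype.ext h)))) (hmono hij.le)
    refine ⟨x, hx, σ.symm (e ⟨C, hC⟩), ?_, by simpa using hAC⟩
    by_contra! hle
    have := hmono hle
    simp only [hf, Function.comp_apply, Equiv.apply_symm_apply, Equiv.symm_apply_apply] at this
    exact absurd hlt this.not_gt

end General

/-! ### Replacing vertices by copies -/

section Blowup
variable {U V : Type*} (π : U → V)

/-- Every vertex of `K` is the image of an element of `S`. -/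
def Covers (S : Finset U) (K : FaceComplex V) : Prop :=
  ∀ x, {x} ∈ K.faces → ∃ s ∈ S, π s = x

variable {π} {S : Finset U} {K : FaceComplex V}

lemma Covers.mono {L : FaceComplex V} (h : Covers π S K) (hL : L.faces ⊆ K.faces) :
    Covers π S L :=
  fun x hx => h x (hL hx)

section
variable [DecidableEq U]

lemma Covers.erase {s t : U} (hS : Covers π S K) (ht : t ∈ S) (hts : t ≠ s) (h : π t = π s) :
    Covers π (S.erase s) K := by
  intro x hx
  obtain ⟨u, hu, rfl⟩ := hS x hx
  by_cases hus : u = s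
  · exact ⟨t, by simp [ht, hts], by rw [h, hus]⟩
  · exact ⟨u, by simp [hu, hus], rfl⟩

lemma Covers.erase_del {s : U} (hS : Covers π S K) : Covers π (S.erase s) (K.del {π s}) := by
  intro x hx
  rw [mem_del_singleton, Finset.notMem_singleton] at hx
  obtain ⟨u, hu, rfl⟩ := hS x hx.1
  exact ⟨u, Finset.mem_erase.2 ⟨fun h => hx.2 (by rw [h]), hu⟩, rfl⟩

end

variable [DecidableEq V]

lemma Covers.link (hS : Covers π S K) (x : V) : Covers π S (K.link {x}) :=
  hS.mono fun _ h => h.1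

variable (π) in
/-- The complex on `S` obtained from `K` by replacing each vertex with its fibre under `π`: a face
picks at most one element from each fibre, over the vertices of a face of `K`. -/
def blowup (S : Finset U) (K : FaceComplex V) : FaceComplex U where
  faces := {F | F ⊆ S ∧ Set.InjOn π F ∧ F.image π ∈ K.faces}
  down_closed := fun h hs => ⟨hs.trans h.1, h.2.1.mono (Finset.coe_subset.2 hs),
    K.down_closed h.2.2 (Finset.image_subset_image hs)⟩

variable [DecidableEq U]

/-- Keep `F` and add one representative from `S` for each vertex of `E` not yet hit. -/
lemma exists_blowup_lift (hS : Covers π S K) {F : Finset U} (hF : F ∈ (blowup π S K).faces)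
    {E : Finset V} (hE : E ∈ K.faces) (hFE : F.image π ⊆ E) :
    ∃ F' ∈ (blowup π S K).faces, F ⊆ F' ∧ F'.image π = E := by
  obtain ⟨hFS, hinj, -⟩ := hF
  have : ∀ x : E, ∃ s, s ∈ S ∧ π s = x := fun x =>
    hS x (K.down_closed hE (by simp))
  choose g hgS hg using this
  set F' := F ∪ ((E.attach.filter fun x => x.1 ∉ F.image π).image g) with hF'
  have himg : F'.image π = E := by
    ext x
    simp only [hF', Finset.mem_image, Finset.mem_union, Finset.mem_filter, Finset.mem_attach,
      true_and]
    constructor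
    · rintro ⟨u, hu | ⟨y, -, rfl⟩, rfl⟩
      · exact hFE (Finset.mem_image_of_mem _ hu)
      · rw [hg]; exact y.2
    · intro hx
      by_cases h : x ∈ F.image π
      · obtain ⟨u, hu, rfl⟩ := Finset.mem_image.1 h
        exact ⟨u, Or.inl hu, rfl⟩
      · exact ⟨g ⟨x, hx⟩, Or.inr ⟨⟨x, hx⟩, by simpa using h, rfl⟩, hg _⟩
  refine ⟨F', ⟨?_, ?_, himg ▸ hE⟩, Finset.subset_union_left, himg⟩
  · refine Finset.union_subset hFS fun u hu => ?_
    obtain ⟨x, -, rfl⟩ := Finset.mem_image.1 hu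
    exact hgS x
  · intro u hu v hv huv
    simp only [hF', Finset.coe_union, Set.mem_union, Finset.mem_coe, Finset.mem_image,
      Finset.mem_filter, Finset.mem_attach, true_and] at hu hv
    rcases hu with hu | ⟨x, hx, rfl⟩ <;> rcases hv with hv | ⟨y, hy, rfl⟩
    · exact hinj hu hv huv
    · exact absurd ⟨u, hu, huv.trans (hg y)⟩ hy
    · exact absurd ⟨v, hv, huv.symm.trans (hg x)⟩ hx
    · rw [hg, hg] at huv
      rw [Subtype.ext huv]

lemma isFacet_blowup (hS : Covers π S K) {F : Finset U} (hF : F ∈ (blowup π S K).faces) :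
    (blowup π S K).IsFacet F ↔ K.IsFacet (F.image π) := by
  simp only [isFacet_iff]
  constructor
  · rintro ⟨-, h⟩
    refine ⟨hF.2.2, fun E hE hFE => ?_⟩
    obtain ⟨F', hF', hsub, rfl⟩ := exists_blowup_lift hS hF hE hFE
    exact Finset.image_subset_image (h _ hF' hsub)
  · rintro ⟨-, h⟩
    refine ⟨hF, fun E hE hFE u hu => ?_⟩
    obtain ⟨v, hv, hvu⟩ := Finset.mem_image.1
      (h _ hE.2.2 (Finset.image_subset_image hFE) (Finset.mem_image_of_mem π hu))
    exact hE.2.1 (hFE hv) hu hvu ▸ hv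

lemma exists_isFacet_blowup (hS : Covers π S K) {E : Finset V} (hE : K.IsFacet E) :
    ∃ F, (blowup π S K).IsFacet F ∧ F.image π = E := by
  obtain ⟨F, hF, -, rfl⟩ := exists_blowup_lift hS (F := ∅)
    ⟨by simp, by simp, K.down_closed hE.1 (by simp)⟩ hE.1 (by simp)
  exact ⟨F, (isFacet_blowup hS hF).2 hE, rfl⟩

lemma isPure_blowup (hS : Covers π S K) : (blowup π S K).IsPure ↔ K.IsPure := by
  constructor
  · intro h E₁ E₂ hE₁ hE₂
    obtain ⟨F₁, hF₁, rfl⟩ := exists_isFacet_blowup hS hE₁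
    obtain ⟨F₂, hF₂, rfl⟩ := exists_isFacet_blowup hS hE₂
    rw [Finset.card_image_of_injOn hF₁.1.2.1, Finset.card_image_of_injOn hF₂.1.2.1]
    exact h _ _ hF₁ hF₂
  · intro h F₁ F₂ hF₁ hF₂
    rw [← Finset.card_image_of_injOn hF₁.1.2.1, ← Finset.card_image_of_injOn hF₂.1.2.1]
    exact h _ _ ((isFacet_blowup hS hF₁.1).1 hF₁) ((isFacet_blowup hS hF₂.1).1 hF₂)

/-- `S` need not shrink: no face of the link of `π s` contains `π s`, so the whole fibre of `s`
becomes unusable. -/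
lemma link_blowup {s : U} (hs : s ∈ S) :
    (blowup π S K).link {s} = blowup π S (K.link {π s}) := by
  ext F
  simp only [mem_link_singleton, blowup, Set.mem_ofPred_eq, Finset.insert_subset_iff,
    Finset.image_insert, Finset.coe_insert]
  constructor
  · rintro ⟨h1, ⟨-, h2⟩, h3, h4⟩
    have h5 := (Set.injOn_insert (by simpa using h1)).1 h3
    exact ⟨h2, h5.1, by simpa using h5.2, h4⟩
  · rintro ⟨h1, h2, h3, h4⟩
    have h5 : s ∉ F := fun h => h3 (Finset.mem_image_of_mem _ h)
    exact ⟨h5, ⟨hs, h1⟩, (Set.injOn_insert (by simpa using h5)).2 ⟨h2, by simpa using h3⟩, h4⟩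

lemma del_blowup {s : U} : (blowup π S K).del {s} = blowup π (S.erase s) K := by
  ext F
  simp only [mem_del_singleton, blowup, Set.mem_ofPred_eq, Finset.subset_erase]
  tauto

lemma blowup_erase {s : U} (h : ∀ t ∈ S, π t = π s → t = s) :
    blowup π (S.erase s) K = blowup π (S.erase s) (K.del {π s}) := by
  ext F
  simp only [blowup, Set.mem_ofPred_eq, mem_del_singleton]
  refine and_congr_right fun hF => and_congr_right fun _ => ?_
  refine ⟨fun h' => ⟨h', fun hs => ?_⟩, And.left⟩
  obtain ⟨t, ht, hts⟩ := Finset.mem_image.1 hs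
  have := Finset.mem_erase.1 (hF ht)
  exact this.1 (h t this.2 hts)

/-- Sheds the copies of `x` in turn. Every link is a blowup of the link of `x`; only removal of the
last copy turns the deletion into a blowup of the deletion of `x`. -/
lemma vertexDecomposable_blowup_of_shed {x : V} (hK : K.IsPure) (hx : {x} ∈ K.faces)
    (hdel : ∀ S, Covers π S (K.del {x}) → (blowup π S (K.del {x})).VertexDecomposable)
    (hlink : ∀ S, Covers π S (K.link {x}) → (blowup π S (K.link {x})).VertexDecomposable)
    (hS : Covers π S K) : (blowup π S K).VertexDecomposable := by
  induction S using Finset.strongInduction with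
  | H S ih =>
    obtain ⟨s, hs, rfl⟩ := hS x hx
    refine .shed _ ((isPure_blowup hS).2 hK) s ?_ ?_ ?_
    · exact ⟨by simpa using hs, by simp, by simpa using hx⟩
    · rw [del_blowup]
      by_cases h : ∀ t ∈ S, π t = π s → t = s
      · rw [blowup_erase h]
        exact hdel _ hS.erase_del
      · push Not at h
        obtain ⟨t, ht, hts, hne⟩ := h
        exact ih _ (Finset.erase_ssubset hs) (hS.erase ht hne hts)
    · rw [link_blowup hs]
      exact hlink _ (hS.link _)

/-- A blowup of a simplex need not be a simplex, so the base case needs its own induction: deletion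
and link of a vertex are both the simplex on the remaining vertices. -/
lemma vertexDecomposable_blowup_of_faces_eq (E : Finset V) :
    ∀ (K : FaceComplex V) (S : Finset U), K.faces = {E' | E' ⊆ E} → Covers π S K →
      (blowup π S K).VertexDecomposable := by
  induction E using Finset.induction_on with
  | empty =>
    intro K S hK hS
    have : (blowup π S K).IsSimplex := by
      refine isSimplex_of_faces_eq (F := ∅) (Set.ext fun F => ?_)
      simp only [blowup, hK, Set.mem_ofPred_eq, Finset.subset_empty, Finset.image_eq_empty]
      exact ⟨fun h => h.2.2, fun h => by simp [h]⟩
    exact .simplex _ this.isPure this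
  | insert x E hxE ih =>
    intro K S hK hS
    have hdel : (K.del {x}).faces = {E' | E' ⊆ E} := by
      ext F
      simp only [mem_del_singleton, hK, Set.mem_ofPred_eq]
      clear * - hxE
      grind
    have hlink : (K.link {x}).faces = {E' | E' ⊆ E} := by
      ext F
      simp only [mem_link_singleton, hK, Set.mem_ofPred_eq]
      refine ⟨fun h y hy => ?_, fun h => ⟨fun hx => hxE (h hx), Finset.insert_subset_insert _ h⟩⟩
      exact (Finset.mem_insert.1 (h.2 (Finset.mem_insert_of_mem hy))).resolve_left
        fun hyx => h.1 (hyx ▸ hy)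
    exact vertexDecomposable_blowup_of_shed (isSimplex_of_faces_eq hK).isPure (x := x)
      (by simp [hK]) (fun S' => ih _ S' hdel) (fun S' => ih _ S' hlink) hS

lemma VertexDecomposable.blowup [Finite V] (hK : K.VertexDecomposable) (hS : Covers π S K) :
    (blowup π S K).VertexDecomposable := by
  induction hK generalizing S with
  | simplex K _ hK =>
    obtain ⟨E, hE⟩ := hK.exists_faces_eq
    exact vertexDecomposable_blowup_of_faces_eq E K S hE hS
  | shed K hpure x hx _ _ ihdel ihlink =>
    exact vertexDecomposable_blowup_of_shed hpure hx (fun _ => ihdel) (fun _ => ihlink) hS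

/-- If the shed element has another copy, its deletion is still a blowup of `K` and suffices by
itself. Otherwise deletion and link are blowups of those of `K`. -/
lemma VertexDecomposable.of_blowup (h : (FaceComplex.blowup π S K).VertexDecomposable)
    (hS : Covers π S K) : K.VertexDecomposable := by
  generalize hB : FaceComplex.blowup π S K = B at h
  induction h generalizing S K with
  | simplex B hpure hs =>
    subst hB
    refine .simplex _ ((isPure_blowup hS).1 hpure) ?_
    obtain ⟨F, hF, huniq⟩ := hs
    refine ⟨F.image π, (isFacet_blowup hS hF.1).1 hF, fun E hE => ?_⟩
    obtain ⟨F', hF', rfl⟩ := exists_isFacet_blowup hS hE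
    rw [huniq F' hF']
  | shed B hpure s hs _ _ ihdel ihlink =>
    subst hB
    have hsS : s ∈ S := by simpa using hs.1
    by_cases h : ∀ t ∈ S, π t = π s → t = s
    · refine .shed _ ((isPure_blowup hS).1 hpure) (π s) (by simpa using hs.2.2) ?_ ?_
      · exact ihdel hS.erase_del (by rw [del_blowup, ← blowup_erase h])
      · exact ihlink (hS.link _) (by rw [link_blowup hsS])
    · push Not at h
      obtain ⟨t, ht, hts, hne⟩ := h
      exact ihdel (hS.erase ht hne hts) del_blowup.symm

lemma Shellable.blowup [Finite U] (hK : K.Shellable) (hS : Covers π S K) :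
    (blowup π S K).Shellable := by
  obtain ⟨r, hinj, hr⟩ := hK.exists_rank
  obtain ⟨n, ⟨e⟩⟩ := Finite.exists_equiv_fin U
  refine shellable_of_rank ((isPure_blowup hS).2 hK.1)
    -- The enumeration `e` orders the copies; facets with equal projection are compared
    -- colexicographically.
    (fun A => toLex (r (A.image π), toColex (A.image e))) fun A B hA hB hne hle => ?_
  have hA' := (isFacet_blowup hS hA.1).1 hA
  have hB' := (isFacet_blowup hS hB.1).1 hB
  rw [Prod.Lex.toLex_le_toLex] at hle
  rcases hle with hlt | ⟨heq, hle⟩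
  · obtain ⟨x, hx, C, hC, hCA, hAC⟩ := hr _ _ hA' hB' hlt
    obtain ⟨⟨a, ha, rfl⟩, hxB⟩ := by simpa only [Finset.mem_sdiff, Finset.mem_image] using hx
    have hface : A.erase a ∈ (FaceComplex.blowup π S K).faces :=
      (FaceComplex.blowup π S K).down_closed hA.1 (Finset.erase_subset _ _)
    have hsub : (A.erase a).image π ⊆ C := by
      intro y hy
      obtain ⟨b, hb, rfl⟩ := Finset.mem_image.1 hy
      rw [Finset.mem_erase] at hb
      by_contra hyC
      have : π b ∈ A.image π \ C := Finset.mem_sdiff.2 ⟨Finset.mem_image_of_mem _ hb.2, hyC⟩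
      rw [hAC, Finset.mem_singleton] at this
      exact hb.1 (hA.1.2.1 hb.2 ha this)
    -- Lifting `C` over `A.erase a` makes `a` the only element of `A` lost.
    obtain ⟨C', hC', hAC', rfl⟩ := exists_blowup_lift hS hface hC.1 hsub
    have haC : π a ∉ C'.image π := by
      have : π a ∈ A.image π \ C'.image π := by simp [hAC]
      exact (Finset.mem_sdiff.1 this).2
    refine ⟨a, Finset.mem_sdiff.2 ⟨ha, fun h => hxB ⟨a, h, rfl⟩⟩, C',
      (isFacet_blowup hS hC').2 hC, ?_, ?_⟩
    · rw [Prod.Lex.toLex_lt_toLex]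
      exact Or.inl hCA
    · ext b
      simp only [Finset.mem_sdiff, Finset.mem_singleton]
      constructor
      · rintro ⟨hb, hbC⟩
        by_contra hba
        exact hbC (hAC' (Finset.mem_erase.2 ⟨hba, hb⟩))
      · rintro rfl
        exact ⟨ha, fun h => haC (Finset.mem_image_of_mem _ h)⟩
  · have himg : B.image π = A.image π := hinj _ _ hB' hA' heq
    have hlt : toColex (B.image e) < toColex (A.image e) :=
      lt_of_le_of_ne hle fun h => hne <| by
        have := toColex.injective h
        exact (Finset.image_injective e.injective this).symm
    -- Here `a` exceeds every element of `B \ A`. Swapping it for the copy `b` of the same vertex in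
    -- `B` lowers the colex order and keeps the projection.
    obtain ⟨a', ha', haB, hmax⟩ := Finset.Colex.toColex_lt_toColex_iff_exists_forall_lt.1 hlt
    obtain ⟨a, ha, rfl⟩ := Finset.mem_image.1 ha'
    simp only [e.injective.mem_finset_image, Finset.mem_image, forall_exists_index, and_imp,
      forall_apply_eq_imp_iff₂] at haB hmax
    obtain ⟨b, hb, hba⟩ := Finset.mem_image.1 (himg ▸ Finset.mem_image_of_mem π ha)
    have hbne : b ≠ a := fun h => haB (h ▸ hb)
    have hbA : b ∉ A := fun h => hbne (hA.1.2.1 h ha hba)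
    have hCimg : (insert b (A.erase a)).image π = A.image π := by
      rw [Finset.image_insert, hba, ← Finset.image_insert, Finset.insert_erase ha]
    have hC : insert b (A.erase a) ∈ (FaceComplex.blowup π S K).faces := by
      refine ⟨Finset.insert_subset (hB.1.1 hb) ((Finset.erase_subset _ _).trans hA.1.1), ?_,
        hCimg ▸ hA.1.2.2⟩
      rw [Finset.coe_insert, Set.injOn_insert (by simp [hbA])]
      refine ⟨hA.1.2.1.mono (by simp), ?_⟩
      rintro ⟨c, hc, hcb⟩
      simp only [Finset.coe_erase, Set.mem_sdiff, Finset.mem_coe, Set.mem_singleton_iff] at hc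
      exact hc.2 (hA.1.2.1 hc.1 ha (hcb.trans hba))
    refine ⟨a, Finset.mem_sdiff.2 ⟨ha, haB⟩, _,
      (isFacet_blowup hS hC).2 (hCimg ▸ hA'), ?_, ?_⟩
    · rw [Prod.Lex.toLex_lt_toLex]
      refine Or.inr ⟨congrArg r hCimg, ?_⟩
      refine Finset.Colex.toColex_lt_toColex_iff_exists_forall_lt.2 ⟨e a, by simpa using ha, ?_, ?_⟩
      · simpa [e.injective.mem_finset_image] using hbne.symm
      · intro c hc hcA
        obtain ⟨c, -, rfl⟩ := Finset.mem_image.1 hc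
        rw [e.injective.mem_finset_image] at hc hcA
        rcases Finset.mem_insert.1 hc with rfl | hc
        · exact hmax _ hb (by simpa using hcA)
        · exact absurd (Finset.mem_of_mem_erase hc) hcA
    · ext c
      simp only [Finset.mem_sdiff, Finset.mem_insert, Finset.mem_erase, Finset.mem_singleton]
      constructor
      · rintro ⟨hc, h⟩
        by_contra hca
        exact h (Or.inr ⟨hca, hc⟩)
      · rintro rfl
        exact ⟨ha, by simp [hbne.symm]⟩

end Blowup

/-! ### Connectedness of facets in codimension one -/

section General
variable {V : Type*} {K : FaceComplex V}

lemma exists_isFacet_of_empty_mem [Finite V] (h : ∅ ∈ K.faces) : ∃ F, K.IsFacet F := by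
  obtain ⟨F, hF, -⟩ := exists_isFacet_superset h
  exact ⟨F, hF⟩

variable [DecidableEq V]

lemma VertexDecomposable.isPure (h : K.VertexDecomposable) : K.IsPure := by
  cases h <;> assumption

lemma VertexDecomposable.empty_mem (h : K.VertexDecomposable) : ∅ ∈ K.faces := by
  cases h with
  | simplex _ _ hK =>
    obtain ⟨F, hF, -⟩ := hK
    exact K.down_closed hF.1 (by simp)
  | shed _ _ x hx _ _ => exact K.down_closed hx (by simp)

lemma VertexDecomposable.exists_shed (h : K.VertexDecomposable) (hK : ¬ K.IsSimplex) :
    ∃ x, {x} ∈ K.faces ∧ (K.del {x}).VertexDecomposable ∧ (K.link {x}).VertexDecomposable := by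
  cases h with
  | simplex _ _ hs => exact absurd hs hK
  | shed _ _ x hx hdel hlink => exact ⟨x, hx, hdel, hlink⟩

/-- `A` and `B` are facets, and `B` misses at most one element of `A`. -/
def FacetAdj (K : FaceComplex V) (A B : Finset V) : Prop :=
  K.IsFacet A ∧ K.IsFacet B ∧ ∃ x, A.erase x ⊆ B

/-- Any two facets are joined by a sequence of adjacent facets. -/
def FacetConnected (K : FaceComplex V) : Prop :=
  ∀ A B, K.IsFacet A → K.IsFacet B →
    Relation.EqvGen K.FacetAdj A B

lemma FacetConnected.apply_eq {α : Type*} (h : K.FacetConnected) (f : Finset V → α)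
    (hf : ∀ A B x, K.IsFacet A → K.IsFacet B → A.erase x ⊆ B → f A = f B) {A B : Finset V}
    (hA : K.IsFacet A) (hB : K.IsFacet B) : f A = f B := by
  induction h A B hA hB with
  | rel A B h =>
    obtain ⟨hA, hB, x, hx⟩ := h
    exact hf A B x hA hB hx
  | refl => rfl
  | symm A B _ ih => exact (ih hB hA).symm
  | trans A B C h₁ h₂ ih₁ ih₂ =>
    -- The generated equivalence lives on all finsets, but related sets are facets simultaneously,
    -- so the intermediate set is one.
    have hB' : K.IsFacet B := by
      clear ih₁ ih₂ hB h₂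
      have : K.IsFacet A ↔ K.IsFacet B := by
        clear hA
        induction h₁ with
        | rel A B h => exact iff_of_true h.1 h.2.1
        | refl => rfl
        | symm _ _ _ ih => exact ih.symm
        | trans _ _ _ _ _ ih₁ ih₂ => exact ih₁.trans ih₂
      exact this.1 hA
    exact (ih₁ hA hB').trans (ih₂ hB' hB)

/-- Every facet but the first is adjacent to an earlier one, so all descend to the facet of least
rank. -/
lemma Shellable.facetConnected (h : K.Shellable) : K.FacetConnected := by
  obtain ⟨r, hinj, hr⟩ := h.exists_rank
  suffices H : ∀ n, ∀ A B, K.IsFacet A → K.IsFacet B → r A = n → (∀ C, K.IsFacet C → r B ≤ r C) →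
      Relation.EqvGen K.FacetAdj A B by
    intro A B hA hB
    obtain ⟨C, hC, hmin⟩ := (InvImage.wf r wellFounded_lt).has_min {C | K.IsFacet C} ⟨A, hA⟩
    have hmin' : ∀ D, K.IsFacet D → r C ≤ r D := fun D hD => not_lt.1 (hmin D hD)
    exact .trans _ _ _ (H _ _ _ hA hC rfl hmin') (.symm _ _ (H _ _ _ hB hC rfl hmin'))
  intro n
  induction n using Nat.strong_induction_on with
  | _ n ih =>
    rintro A B hA hB rfl hmin
    rcases (hmin A hA).lt_or_eq with hlt | heq
    · obtain ⟨x, -, C, hC, hCA, hAC⟩ := hr A B hA hB hlt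
      refine .trans _ C _ (.rel _ _ ⟨hA, hC, x, fun y hy => ?_⟩) (ih _ hCA _ _ hC hB rfl hmin)
      rw [Finset.mem_erase] at hy
      by_contra hyC
      have : y ∈ A \ C := Finset.mem_sdiff.2 ⟨hy.2, hyC⟩
      rw [hAC, Finset.mem_singleton] at this
      exact hy.1 this
    · exact hinj _ _ hB hA heq ▸ .refl _

lemma EqvGen.map {α β : Type*} {r : α → α → Prop} {s : β → β → Prop} {f : α → β}
    (h : ∀ a b, r a b → s (f a) (f b)) {a b : α} (hab : Relation.EqvGen r a b) :
    Relation.EqvGen s (f a) (f b) := by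
  induction hab with
  | rel a b hab => exact .rel _ _ (h a b hab)
  | refl => exact .refl _
  | symm _ _ _ ih => exact .symm _ _ ih
  | trans _ _ _ _ _ ih₁ ih₂ => exact .trans _ _ _ ih₁ ih₂

/-- Facets containing `x` are joined through the link. If some facet avoids `x`, each facet
containing `x` is adjacent to one avoiding it, and those are joined through the deletion. -/
lemma VertexDecomposable.facetConnected [Finite V] (h : K.VertexDecomposable) :
    K.FacetConnected := by
  induction h with
  | simplex K _ hK =>
    intro A B hA hB
    rw [hK.unique hA hB]
    exact .refl _
  | shed K hpure x hx hdel hlink ihdel ihlink =>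
    have hcontain : ∀ A B, K.IsFacet A → K.IsFacet B → x ∈ A → x ∈ B →
        Relation.EqvGen K.FacetAdj A B := by
      intro A B hA hB hxA hxB
      rw [← Finset.insert_erase hxA] at hA ⊢
      rw [← Finset.insert_erase hxB] at hB ⊢
      refine EqvGen.map (f := insert x) ?_ (ihlink _ _ (isFacet_link_singleton.2 ⟨by simp, hA⟩)
        (isFacet_link_singleton.2 ⟨by simp, hB⟩))
      rintro C D ⟨hC, hD, y, hy⟩
      rw [isFacet_link_singleton] at hC hD
      refine ⟨hC.2, hD.2, y, fun z hz => ?_⟩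
      simp only [Finset.mem_erase, Finset.mem_insert] at hz ⊢
      exact hz.2.imp_right fun h => hy (Finset.mem_erase.2 ⟨hz.1, h⟩)
    by_cases hcone : ∀ A, K.IsFacet A → x ∈ A
    · exact fun A B hA hB => hcontain A B hA hB (hcone A hA) (hcone B hB)
    push Not at hcone
    obtain ⟨A₀, hA₀, hxA₀⟩ := hcone
    -- `A₀` is also a facet of the deletion, so by purity the facets of the deletion have the full
    -- size of facets of `K`.
    have hfacet : ∀ A, (K.del {x}).IsFacet A → K.IsFacet A := by
      intro A hA
      obtain ⟨B, hB, hAB⟩ := exists_isFacet_superset (mem_del_singleton.1 hA.1).1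
      have h1 := hdel.isPure _ _ hA (isFacet_del_of_isFacet hA₀ hxA₀)
      rw [Finset.eq_of_subset_of_card_le hAB (by rw [h1, hpure _ _ hA₀ hB])]
      exact hB
    have hto : ∀ A, K.IsFacet A → ∃ B, K.IsFacet B ∧ x ∉ B ∧
        Relation.EqvGen K.FacetAdj A B := by
      intro A hA
      by_cases hxA : x ∈ A
      · obtain ⟨B, hB, hAB⟩ := exists_isFacet_superset (K := K.del {x}) (F := A.erase x)
          (mem_del_singleton.2 ⟨K.down_closed hA.1 (Finset.erase_subset _ _), by simp⟩)
        exact ⟨B, hfacet B hB, (mem_del_singleton.1 hB.1).2, .rel _ _ ⟨hA, hfacet B hB, x, hAB⟩⟩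
      · exact ⟨A, hA, hxA, .refl _⟩
    intro A B hA hB
    obtain ⟨A', hA', hxA', hAA'⟩ := hto A hA
    obtain ⟨B', hB', hxB', hBB'⟩ := hto B hB
    refine .trans _ _ _ hAA' (.trans _ _ _ ?_ (.symm _ _ hBB'))
    refine EqvGen.map (f := id) ?_ (ihdel _ _ (isFacet_del_of_isFacet hA' hxA')
      (isFacet_del_of_isFacet hB' hxB'))
    rintro C D ⟨hC, hD, y, hy⟩
    exact ⟨hfacet C hC, hfacet D hD, y, hy⟩

end General

/-! ### Joins of complexes -/

section FiberJoin
variable {V W : Type*} [DecidableEq V] [DecidableEq W]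

/-- The part of `F` over `v`. -/
def fiber (F : Finset (V × W)) (v : V) : Finset W :=
  (F.filter fun p => p.1 = v).image Prod.snd

@[simp]
lemma mem_fiber {F : Finset (V × W)} {v : V} {w : W} : w ∈ fiber F v ↔ (v, w) ∈ F := by
  simp [fiber]

lemma fiber_mono {F E : Finset (V × W)} (h : F ⊆ E) (v : V) : fiber F v ⊆ fiber E v :=
  fun w hw => by simpa using h (by simpa using hw)

lemma fiber_insert_self (F : Finset (V × W)) (v : V) (x : W) :
    fiber (insert (v, x) F) v = insert x (fiber F v) := by
  ext; simp

lemma fiber_insert_of_ne (F : Finset (V × W)) {u v : V} (x : W) (h : u ≠ v) :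
    fiber (insert (v, x) F) u = fiber F u := by
  ext; simp [h]

lemma fiber_singleton_self (v : V) (x : W) : fiber {(v, x)} v = {x} := by
  ext; simp

lemma subset_of_fiber_subset {F E : Finset (V × W)} (h : ∀ v, fiber F v ⊆ fiber E v) : F ⊆ E :=
  fun p hp => mem_fiber.1 (h p.1 (mem_fiber.2 hp))

lemma ext_fiber {F E : Finset (V × W)} (h : ∀ v, fiber F v = fiber E v) : F = E :=
  (subset_of_fiber_subset fun v => (h v).subset).antisymm
    (subset_of_fiber_subset fun v => (h v).superset)

lemma card_eq_sum_fiber [Fintype V] (F : Finset (V × W)) :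
    F.card = ∑ v, (fiber F v).card := by
  rw [Finset.card_eq_sum_card_fiberwise (f := Prod.fst) (t := Finset.univ) (by simp)]
  refine Finset.sum_congr rfl fun v _ => (Finset.card_image_of_injOn ?_).symm
  rintro ⟨a, b⟩ h ⟨c, d⟩ h' hbd
  simp_all

/-- The join of the complexes `Δ v`, on disjoint copies of `W`. -/
def fiberJoin (Δ : V → FaceComplex W) : FaceComplex (V × W) where
  faces := {F | ∀ v, fiber F v ∈ (Δ v).faces}
  down_closed := fun h hs v => (Δ v).down_closed (h v) (fiber_mono hs v)

lemma mem_fiberJoin {Δ : V → FaceComplex W} {F : Finset (V × W)} :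
    F ∈ (fiberJoin Δ).faces ↔ ∀ v, fiber F v ∈ (Δ v).faces := Iff.rfl

/-- A link changes a single factor; this is why joins of non-constant families are needed. -/
lemma link_fiberJoin (Δ : V → FaceComplex W) (v : V) (x : W) :
    (fiberJoin Δ).link {(v, x)} = fiberJoin (Function.update Δ v ((Δ v).link {x})) := by
  ext F
  rw [mem_link_singleton, mem_fiberJoin, mem_fiberJoin,
    Function.forall_update_iff Δ (fun u K => fiber F u ∈ K.faces), mem_link_singleton, mem_fiber,
    ← fiber_insert_self, and_assoc]
  refine and_congr_right fun _ => ⟨fun h => ⟨h v, fun u hu => ?_⟩, fun h u => ?_⟩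
  · rw [← fiber_insert_of_ne F x hu]
    exact h u
  · by_cases hu : u = v
    · exact hu ▸ h.1
    · rw [fiber_insert_of_ne F x hu]
      exact h.2 u hu

lemma del_fiberJoin (Δ : V → FaceComplex W) (v : V) (x : W) :
    (fiberJoin Δ).del {(v, x)} = fiberJoin (Function.update Δ v ((Δ v).del {x})) := by
  ext F
  rw [mem_del_singleton, mem_fiberJoin, mem_fiberJoin,
    Function.forall_update_iff Δ (fun u K => fiber F u ∈ K.faces), mem_del_singleton, mem_fiber]
  refine ⟨fun h => ⟨⟨h.1 v, h.2⟩, fun u _ => h.1 u⟩, fun h => ⟨fun u => ?_, h.1.2⟩⟩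
  by_cases hu : u = v
  · exact hu ▸ h.1.1
  · exact h.2 u hu

variable [Fintype V] [Fintype W]

/-- The set with prescribed fibres. -/
def glue (g : V → Finset W) : Finset (V × W) :=
  Finset.univ.filter fun p => p.2 ∈ g p.1

omit [DecidableEq V] in
@[simp]
lemma mem_glue {g : V → Finset W} {p : V × W} : p ∈ glue g ↔ p.2 ∈ g p.1 := by
  simp [glue]

@[simp]
lemma fiber_glue (g : V → Finset W) (v : V) : fiber (glue g) v = g v := by
  ext; simp

variable {Δ : V → FaceComplex W}

lemma isFacet_fiberJoin {F : Finset (V × W)} :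
    (fiberJoin Δ).IsFacet F ↔ ∀ v, (Δ v).IsFacet (fiber F v) := by
  simp only [isFacet_iff]
  constructor
  · rintro ⟨h1, h2⟩ v
    refine ⟨h1 v, fun E hE hFE => ?_⟩
    have key : ∀ u, fiber F u ⊆ Function.update (fiber F) v E u := fun u => by
      by_cases hu : u = v
      · subst hu; simpa using hFE
      · simp [hu]
    have := fiber_mono (h2 (glue (Function.update (fiber F) v E)) (fun u => ?_)
      (subset_of_fiber_subset fun u => by simpa using key u)) v
    · simpa using this
    · rw [fiber_glue]
      by_cases hu : u = v
      · subst hu; simpa using hE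
      · simpa [hu] using h1 u
  · intro h
    exact ⟨fun v => (h v).1, fun E hE hFE => subset_of_fiber_subset fun v =>
      (h v).2 _ (hE v) (fiber_mono hFE v)⟩

lemma isFacet_glue_update {g : V → Finset W} (hg : ∀ v, (Δ v).IsFacet (g v)) {v : V}
    {E : Finset W} (hE : (Δ v).IsFacet E) :
    (fiberJoin Δ).IsFacet (glue (Function.update g v E)) := by
  rw [isFacet_fiberJoin]
  intro u
  rw [fiber_glue]
  by_cases hu : u = v
  · subst hu; simpa using hE
  · simpa [hu] using hg u

lemma isPure_fiberJoin (h : ∀ v, (Δ v).IsPure) : (fiberJoin Δ).IsPure := by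
  intro F E hF hE
  rw [isFacet_fiberJoin] at hF hE
  rw [card_eq_sum_fiber, card_eq_sum_fiber]
  exact Finset.sum_congr rfl fun v _ => h v _ _ (hF v) (hE v)

/-- Fix facets in the other factors and vary the one at `v`. A void factor would make the join void,
hence `h0`. -/
lemma isPure_of_fiberJoin (h0 : ∀ v, ∅ ∈ (Δ v).faces) (h : (fiberJoin Δ).IsPure) (v : V) :
    (Δ v).IsPure := by
  choose g hg using fun v => exists_isFacet_of_empty_mem (h0 v)
  intro E₁ E₂ hE₁ hE₂
  have := h _ _ (isFacet_glue_update hg hE₁) (isFacet_glue_update hg hE₂)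
  simp only [card_eq_sum_fiber, fiber_glue] at this
  rw [← Finset.add_sum_erase _ _ (Finset.mem_univ v),
    ← Finset.add_sum_erase (a := v) _ (fun u => (Function.update g v E₂ u).card)
      (Finset.mem_univ v)] at this
  simp only [Function.update_self] at this
  rwa [Finset.sum_congr rfl (g := fun u => (Function.update g v E₂ u).card) fun u hu => by
    simp [(Finset.mem_erase.1 hu).1], add_left_inj] at this

/-- Shed a vertex `x` of a non-simplex factor. Its deletion and link both lose the face `{x}`, so
the total number of faces drops. -/
lemma vertexDecomposable_fiberJoin (hΔ : ∀ v, (Δ v).VertexDecomposable) :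
    (fiberJoin Δ).VertexDecomposable := by
  induction hn : ∑ v, (Δ v).faces.ncard using Nat.strong_induction_on generalizing Δ with
  | _ n ih =>
    subst hn
    have hpure := isPure_fiberJoin fun v => (hΔ v).isPure
    by_cases hs : ∀ v, (Δ v).IsSimplex
    · refine .simplex _ hpure ?_
      choose g hg huniq using hs
      refine ⟨glue g, isFacet_fiberJoin.2 fun v => by simpa using hg v, fun F hF => ?_⟩
      exact ext_fiber fun v => by simpa using huniq v _ (isFacet_fiberJoin.1 hF v)
    · push Not at hs
      obtain ⟨v, hv⟩ := hs
      obtain ⟨x, hx, hdel, hlink⟩ := (hΔ v).exists_shed hv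
      have step : ∀ L : FaceComplex W, L.VertexDecomposable → L.faces ⊆ (Δ v).faces →
          {x} ∉ L.faces → (fiberJoin (Function.update Δ v L)).VertexDecomposable := by
        intro L hL hsub hxL
        refine ih _ ?_ (fun u => ?_) rfl
        · refine Finset.sum_lt_sum (fun u _ => ?_) ⟨v, Finset.mem_univ v, ?_⟩
          · by_cases hu : u = v
            · subst hu
              simpa using Set.ncard_le_ncard hsub (Set.toFinite _)
            · simp [hu]
          · simpa using Set.ncard_lt_ncard ⟨hsub, fun h => hxL (h hx)⟩ (Set.toFinite _)
        · by_cases hu : u = v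
          · subst hu; simpa using hL
          · simpa [hu] using hΔ u
      refine .shed _ hpure (v, x) (fun u => ?_) ?_ ?_
      · by_cases hu : u = v
        · subst hu
          rwa [fiber_singleton_self]
        · have : fiber {(v, x)} u = ∅ := by ext; simp [hu]
          rw [this]
          exact (hΔ u).empty_mem
      · rw [del_fiberJoin]
        exact step _ hdel (fun F hF => hF.1) (by simp)
      · rw [link_fiberJoin]
        exact step _ hlink (fun F hF => hF.1) (by simp)

/-- A vertex shed in the factor `v` is shed from `Δ v`; one shed in another factor leaves `Δ v`
intact in the deletion. -/
lemma VertexDecomposable.of_fiberJoin (h : (fiberJoin Δ).VertexDecomposable)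
    (h0 : ∀ v, ∅ ∈ (Δ v).faces) (v : V) : (Δ v).VertexDecomposable := by
  generalize hJ : fiberJoin Δ = J at h
  induction h generalizing Δ with
  | simplex J hpure hs =>
    subst hJ
    refine .simplex _ (isPure_of_fiberJoin h0 hpure v) ?_
    obtain ⟨F, hF, huniq⟩ := hs
    refine ⟨fiber F v, isFacet_fiberJoin.1 hF v, fun E hE => ?_⟩
    rw [← huniq _ (isFacet_glue_update (isFacet_fiberJoin.1 hF) hE)]
    simp
  | shed J hpure p hp _ _ ihdel ihlink =>
    subst hJ
    obtain ⟨u, x⟩ := p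
    have hx : {x} ∈ (Δ u).faces := fiber_singleton_self u x ▸ hp u
    have h0' : ∀ L : FaceComplex W, ∅ ∈ L.faces → ∀ v, ∅ ∈ (Function.update Δ u L v).faces := by
      intro L hL v
      by_cases hv : v = u
      · subst hv; simpa using hL
      · simpa [hv] using h0 v
    have hdel := ihdel (h0' _ (mem_del_singleton.2 ⟨h0 u, by simp⟩)) (del_fiberJoin Δ u x).symm
    have hlink := ihlink (h0' _ (empty_mem_link hx)) (link_fiberJoin Δ u x).symm
    by_cases hv : v = u
    · subst hv
      rw [Function.update_self] at hdel hlink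
      exact .shed _ (isPure_of_fiberJoin h0 hpure v) x hx hdel hlink
    · rwa [Function.update_of_ne hv] at hdel

lemma shellable_fiberJoin (hΔ : ∀ v, (Δ v).Shellable) : (fiberJoin Δ).Shellable := by
  choose r hinj hr using fun v => (hΔ v).exists_rank
  refine shellable_of_rank (isPure_fiberJoin fun v => (hΔ v).1)
    (fun A => ∑ v, r v (fiber A v)) fun A B hA hB hne hle => ?_
  rw [isFacet_fiberJoin] at hA hB
  -- Otherwise the rank sums agree termwise and `A = B`. Only the fibre at this `v` is then
  -- replaced.
  obtain ⟨v, hv⟩ : ∃ v, r v (fiber B v) < r v (fiber A v) := by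
    by_contra! hge
    have heq := (Finset.sum_eq_sum_iff_of_le fun v _ => hge v).1
      (le_antisymm (Finset.sum_le_sum fun v _ => hge v) hle)
    exact hne (ext_fiber fun v => hinj v _ _ (hA v) (hB v) (heq v (Finset.mem_univ v)))
  obtain ⟨x, hx, C, hC, hlt, hAC⟩ := hr v _ _ (hA v) (hB v) hv
  refine ⟨(v, x), by simpa using hx, _, isFacet_glue_update hA hC, ?_, ?_⟩
  · refine Finset.sum_lt_sum (fun u _ => ?_) ⟨v, Finset.mem_univ v, by simpa using hlt⟩
    by_cases hu : u = v
    · subst hu; simpa using hlt.le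
    · simp [hu]
  · refine ext_fiber fun u => ?_
    ext w
    by_cases hu : u = v
    · subst hu
      simpa using Finset.ext_iff.1 hAC w
    · simp [hu]

/-- Restrict the shelling to the facets with prescribed fibres `g` away from `v`. -/
lemma Shellable.of_fiberJoin (h : (fiberJoin Δ).Shellable) (h0 : ∀ v, ∅ ∈ (Δ v).faces) (v : V) :
    (Δ v).Shellable := by
  choose g hg using fun v => exists_isFacet_of_empty_mem (h0 v)
  obtain ⟨r, hinj, hr⟩ := h.exists_rank
  refine shellable_of_rank (isPure_of_fiberJoin h0 h.1 v)
    (fun E => r (glue (Function.update g v E))) fun E E' hE hE' hne hle => ?_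
  have hA := isFacet_glue_update hg hE
  have hB := isFacet_glue_update hg hE'
  have hlt := lt_of_le_of_ne hle fun h => hne <| by
    simpa using congrArg (fiber · v) (hinj _ _ hB hA h).symm
  obtain ⟨⟨u, x⟩, hx, C, hC, hCA, hAC⟩ := hr _ _ hA hB hlt
  obtain rfl : u = v := by
    by_contra hu
    simp [hu] at hx
  have hAC' : ∀ t w, (w ∈ Function.update g u E t ∧ (t, w) ∉ C) ↔ t = u ∧ w = x := by
    intro t w
    simpa using Finset.ext_iff.1 hAC (t, w)
  -- `C` stays in the restricted family: away from `u` it loses nothing of `g t`, which is already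
  -- maximal.
  have hCeq : glue (Function.update g u (fiber C u)) = C := by
    refine ext_fiber fun t => ?_
    rw [fiber_glue]
    by_cases ht : t = u
    · subst ht; simp
    · rw [Function.update_of_ne ht]
      refine (hg t).eq_of_subset (isFacet_fiberJoin.1 hC t).1 fun w hw => ?_
      by_contra hwC
      exact ht ((hAC' t w).1 ⟨by simpa [ht] using hw, by simpa using hwC⟩).1
  refine ⟨x, by simpa using hx, fiber C u, isFacet_fiberJoin.1 hC u, hCeq.symm ▸ hCA, ?_⟩
  ext w
  simpa using hAC' u w

end FiberJoin

end FaceComplex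

open FaceComplex

/-! ### Independence complexes of lexicographic products -/

section Graph
variable {V W : Type*} {G : SimpleGraph V} {H : SimpleGraph W}

lemma mem_indComplex {F : Finset V} :
    F ∈ (indComplex G).faces ↔ ∀ a ∈ F, ∀ b ∈ F, ¬ G.Adj a b :=
  ⟨fun h _ ha _ hb hab => h ha hb hab.ne hab, fun h a ha b hb _ => h a ha b hb⟩

lemma empty_mem_indComplex : ∅ ∈ (indComplex G).faces := by
  simp [mem_indComplex]

lemma eq_top_iff_exists_iso [Finite W] [Nonempty W] :
    (∃ m : ℕ, 1 ≤ m ∧ Nonempty (H ≃g (⊤ : SimpleGraph (Fin m)))) ↔ H = ⊤ := by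
  constructor
  · rintro ⟨m, -, ⟨e⟩⟩
    ext a b
    rw [← e.map_adj_iff]
    simp
  · rintro rfl
    exact ⟨Nat.card W, Nat.card_pos, ⟨SimpleGraph.Iso.completeGraph (Finite.equivFin W)⟩⟩

lemma indComplex_lexProduct_of_isIsolated [DecidableEq V] [DecidableEq W]
    (hG : ∀ v, G.IsIsolated v) :
    indComplex (lexProduct G H) = fiberJoin fun _ => indComplex H := by
  ext F
  simp only [mem_fiberJoin, mem_indComplex, mem_fiber]
  constructor
  · exact fun h v a ha b hb hab => h _ ha _ hb (Or.inr ⟨rfl, hab⟩)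
  · rintro h ⟨u, a⟩ ha ⟨v, b⟩ hb (hab | ⟨huv, hab⟩)
    · exact hG _ _ hab
    · obtain rfl : u = v := huv
      exact h u a ha b hb hab

lemma indComplex_lexProduct_top [Fintype V] [Fintype W] [DecidableEq V] :
    indComplex (lexProduct G (⊤ : SimpleGraph W)) =
      blowup Prod.fst Finset.univ (indComplex G) := by
  ext F
  simp only [blowup, mem_indComplex, Set.mem_ofPred_eq, Finset.subset_univ, true_and,
    Finset.forall_mem_image]
  constructor
  · refine fun h => ⟨fun p hp q hq hpq => ?_, fun p hp q hq hpq => h p hp q hq (Or.inl hpq)⟩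
    by_contra hne
    exact h p hp q hq (Or.inr ⟨hpq, fun h => hne (Prod.ext hpq h)⟩)
  · rintro ⟨hinj, h⟩ p hp q hq (hpq | ⟨hpq, hne⟩)
    · exact h hp hq hpq
    · exact hne (congrArg Prod.snd (hinj hp hq hpq))

lemma covers_fst [Fintype V] [Fintype W] [Nonempty W] (K : FaceComplex V) :
    Covers (Prod.fst : V × W → V) Finset.univ K :=
  fun x _ => ⟨(x, Classical.arbitrary W), Finset.mem_univ _, rfl⟩

/-- A larger face projects to an independent set containing `T`, hence to `T` itself (this uses
`hne`), and its fibres over `T` contain the maximal `E`. -/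
lemma isFacet_product {T : Finset V} {E : Finset W} (hT : (indComplex G).IsFacet T)
    (hE : (indComplex H).IsFacet E) (hne : E.Nonempty) :
    (indComplex (lexProduct G H)).IsFacet (T ×ˢ E) := by
  classical
  have hT' := mem_indComplex.1 hT.1
  have hE' := mem_indComplex.1 hE.1
  obtain ⟨e, he⟩ := hne
  refine isFacet_iff.2 ⟨mem_indComplex.2 ?_, fun F hF hsub p hp => ?_⟩
  · rintro p hp q hq (hpq | ⟨-, hpq⟩)
    · exact hT' _ (Finset.mem_product.1 hp).1 _ (Finset.mem_product.1 hq).1 hpq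
    · exact hE' _ (Finset.mem_product.1 hp).2 _ (Finset.mem_product.1 hq).2 hpq
  · rw [mem_indComplex] at hF
    have hpT : p.1 ∈ T := by
      refine hT.2 (y := F.image Prod.fst) (mem_indComplex.2 ?_) (fun t ht => ?_)
        (Finset.mem_image_of_mem _ hp)
      · simp only [Finset.forall_mem_image]
        exact fun a ha b hb hab => hF a ha b hb (Or.inl hab)
      · exact Finset.mem_image.2 ⟨(t, e), hsub (Finset.mem_product.2 ⟨ht, he⟩), rfl⟩
    refine Finset.mem_product.2 ⟨hpT, hE.2 (y := fiber F p.1) (mem_indComplex.2 ?_)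
      (fun w hw => ?_) (mem_fiber.2 hp)⟩
    · exact fun a ha b hb hab => hF _ (mem_fiber.1 ha) _ (mem_fiber.1 hb) (Or.inr ⟨rfl, hab⟩)
    · exact mem_fiber.2 (hsub (Finset.mem_product.2 ⟨hpT, hw⟩))

variable [DecidableEq V] {A : Finset (V × W)}

lemma image_fst_mem_indComplex (hA : A ∈ (indComplex (lexProduct G H)).faces) :
    A.image Prod.fst ∈ (indComplex G).faces := by
  rw [mem_indComplex] at hA ⊢
  simp only [Finset.forall_mem_image]
  exact fun a ha b hb hab => hA a ha b hb (Or.inl hab)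

variable [DecidableEq W]

/-- If the projection could grow by `v`, then `A` could grow by `(v, w)` for any `w`. -/
lemma isFacet_image_fst [Nonempty W] (hA : (indComplex (lexProduct G H)).IsFacet A) :
    (indComplex G).IsFacet (A.image Prod.fst) := by
  refine isFacet_iff.2 ⟨image_fst_mem_indComplex hA.1, fun T hT hAT v hv => ?_⟩
  have hA1 := mem_indComplex.1 hA.1
  rw [mem_indComplex] at hT
  by_contra hvA
  obtain ⟨w⟩ := ‹Nonempty W›
  have hne : ∀ p ∈ A, p.1 ≠ v := fun p hp h => hvA (h ▸ Finset.mem_image_of_mem _ hp)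
  have hmem : ∀ p ∈ A, p.1 ∈ T := fun p hp => hAT (Finset.mem_image_of_mem _ hp)
  refine hne (v, w) (hA.2 (y := insert (v, w) A) (mem_indComplex.2 ?_)
    (Finset.subset_insert _ _) (Finset.mem_insert_self _ _)) rfl
  intro p hp q hq hpq
  rcases Finset.mem_insert.1 hp with rfl | hp <;> rcases Finset.mem_insert.1 hq with rfl | hq
  · exact hpq.ne rfl
  · rcases hpq with hpq | hpq
    · exact hT _ hv _ (hmem q hq) hpq
    · exact hne q hq hpq.1.symm
  · rcases hpq with hpq | hpq
    · exact hT _ (hmem p hp) _ hv hpq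
    · exact hne p hp hpq.1
  · exact hA1 p hp q hq hpq

lemma isFacet_fiber (hA : (indComplex (lexProduct G H)).IsFacet A) {v : V}
    (hv : v ∈ A.image Prod.fst) : (indComplex H).IsFacet (fiber A v) := by
  have hA1 := mem_indComplex.1 hA.1
  refine isFacet_iff.2 ⟨mem_indComplex.2 fun a ha b hb hab =>
    hA1 _ (mem_fiber.1 ha) _ (mem_fiber.1 hb) (Or.inr ⟨rfl, hab⟩), fun E hE hAE w hw => ?_⟩
  have hE := mem_indComplex.1 hE
  have hG := mem_indComplex.1 (image_fst_mem_indComplex hA.1)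
  have hfst : ∀ p ∈ A, p.1 ∈ A.image Prod.fst := fun p hp => Finset.mem_image_of_mem _ hp
  have hsnd : ∀ p ∈ A, p.1 = v → p.2 ∈ E := by
    rintro ⟨_, b⟩ hp rfl
    exact hAE (mem_fiber.2 hp)
  rw [mem_fiber]
  refine hA.2 (y := insert (v, w) A) (mem_indComplex.2 ?_)
    (Finset.subset_insert _ _) (Finset.mem_insert_self _ _)
  intro p hp q hq hpq
  rcases Finset.mem_insert.1 hp with rfl | hp <;> rcases Finset.mem_insert.1 hq with rfl | hq
  · exact hpq.ne rfl
  · rcases hpq with hpq | hpq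
    · exact hG _ hv _ (hfst q hq) hpq
    · exact hE _ hw _ (hsnd q hq hpq.1.symm) hpq.2
  · rcases hpq with hpq | hpq
    · exact hG _ (hfst p hp) _ hv hpq
    · exact hE _ (hsnd p hp hpq.1) _ hw hpq.2
  · exact hA1 p hp q hq hpq

/-- If `G` has an edge, then `Ind(G[H])` can only be pure and connected in codimension one when
`H` is complete: otherwise all fibres of a facet have at least two elements, so that adjacent
facets have the same projection to `G`. -/
lemma eq_top_of_facetConnected [Finite V] [Finite W] [Nonempty W]
    (hG : ¬ ∀ v, G.IsIsolated v) (hpure : (indComplex (lexProduct G H)).IsPure)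
    (hconn : (indComplex (lexProduct G H)).FacetConnected) : H = ⊤ := by
  by_contra hH
  obtain ⟨a, b, hab, hadj⟩ : ∃ a b, a ≠ b ∧ ¬ H.Adj a b := by
    by_contra! h
    exact hH (SimpleGraph.ext (funext₂ fun a b => propext ⟨fun h => h.ne, h a b⟩))
  obtain ⟨u, v, huv⟩ : ∃ u v, G.Adj u v := by
    simpa [SimpleGraph.IsIsolated] using hG
  have hsingle : ∀ x, ({x} : Finset V) ∈ (indComplex G).faces := fun x => by simp [mem_indComplex]
  obtain ⟨T, hT, huT⟩ := exists_isFacet_superset (hsingle u)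
  obtain ⟨T', hT', hvT'⟩ := exists_isFacet_superset (hsingle v)
  rw [Finset.singleton_subset_iff] at huT hvT'
  have hpair : ({a, b} : Finset W) ∈ (indComplex H).faces := by
    simp [mem_indComplex, hadj, H.adj_comm b a]
  obtain ⟨E, hE, habE⟩ := exists_isFacet_superset hpair
  have hE2 : 2 ≤ E.card := by
    rw [← Finset.card_pair hab]
    exact Finset.card_le_card habE
  have hEne : E.Nonempty := Finset.card_pos.1 (by omega)
  -- Purity equates the sizes of `T ×ˢ F` and `T ×ˢ E`; cancel the size of `T`, which contains `u`.
  have hcard : ∀ F, (indComplex H).IsFacet F → F.Nonempty → 2 ≤ F.card := by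
    intro F hF hFne
    have := hpure _ _ (isFacet_product hT hF hFne) (isFacet_product hT hE hEne)
    rw [Finset.card_product, Finset.card_product] at this
    rw [Nat.eq_of_mul_eq_mul_left (Finset.card_pos.2 ⟨u, huT⟩) this]
    exact hE2
  have hproj : ∀ A B p, (indComplex (lexProduct G H)).IsFacet A →
      (indComplex (lexProduct G H)).IsFacet B → A.erase p ⊆ B →
      A.image Prod.fst = B.image Prod.fst := by
    intro A B p hA hB hAB
    refine (isFacet_image_fst hA).eq_of_subset (image_fst_mem_indComplex hB.1) fun x hx => ?_
    obtain ⟨⟨x, c⟩, hxc, rfl⟩ := Finset.mem_image.1 hx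
    -- The fibre over `x` has a second element, which survives the removal of `p`.
    obtain ⟨d, hd, hdp⟩ := Finset.exists_mem_ne
      (hcard _ (isFacet_fiber hA hx) ⟨c, mem_fiber.2 hxc⟩) p.2
    exact Finset.mem_image.2 ⟨(x, d), hAB (Finset.mem_erase.2
      ⟨fun h => hdp (congrArg Prod.snd h), mem_fiber.1 hd⟩), rfl⟩
  -- Constancy of the projection gives `T = T'`, an independent set containing both ends of the
  -- edge.
  have := hconn.apply_eq (Finset.image Prod.fst) hproj (isFacet_product hT hE hEne)
    (isFacet_product hT' hE hEne)
  rw [Finset.product_image_fst hEne, Finset.product_image_fst hEne] at this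
  exact mem_indComplex.1 hT.1 u huT v (this ▸ hvT') huv

end Graph

theorem theorem1p1 {V W : Type*} [Finite V] [Finite W] [Nonempty V] [Nonempty W]
    [DecidableEq V] [DecidableEq W] (G : SimpleGraph V) (H : SimpleGraph W) :
    -- (a)
    ((∀ v, G.IsIsolated v) →
      ((indComplex H).VertexDecomposable ↔ (indComplex (lexProduct G H)).VertexDecomposable) ∧
      ((indComplex H).Shellable ↔ (indComplex (lexProduct G H)).Shellable)) ∧
    -- (b)
    ((¬ ∀ v, G.IsIsolated v) →
      ((indComplex (lexProduct G H)).VertexDecomposable ↔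
        (indComplex G).VertexDecomposable ∧
          ∃ m : ℕ, 1 ≤ m ∧ Nonempty (H ≃g (⊤ : SimpleGraph (Fin m))))) ∧
    -- (c)
    ((¬ ∀ v, G.IsIsolated v) →
      ((indComplex G).Shellable ∧ (∃ m : ℕ, Nonempty (H ≃g (⊤ : SimpleGraph (Fin m)))) →
        (indComplex (lexProduct G H)).Shellable) ∧
      ((indComplex (lexProduct G H)).Shellable →
        ∃ m : ℕ, 1 ≤ m ∧ Nonempty (H ≃g (⊤ : SimpleGraph (Fin m))))) := by
  have := Fintype.ofFinite V
  have := Fintype.ofFinite W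
  refine ⟨fun hG => ?_, fun hG => ?_, fun hG => ⟨?_, fun h => ?_⟩⟩
  · rw [indComplex_lexProduct_of_isIsolated hG]
    obtain ⟨v⟩ := ‹Nonempty V›
    exact ⟨⟨fun h => vertexDecomposable_fiberJoin fun _ => h,
        fun h => h.of_fiberJoin (fun _ => empty_mem_indComplex) v⟩,
      ⟨fun h => shellable_fiberJoin fun _ => h,
        fun h => h.of_fiberJoin (fun _ => empty_mem_indComplex) v⟩⟩
  · rw [eq_top_iff_exists_iso]
    constructor
    · intro h
      obtain rfl := eq_top_of_facetConnected hG h.isPure h.facetConnected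
      rw [indComplex_lexProduct_top] at h
      exact ⟨h.of_blowup (covers_fst _), rfl⟩
    · rintro ⟨h, rfl⟩
      rw [indComplex_lexProduct_top]
      exact h.blowup (covers_fst _)
  · rintro ⟨h, m, ⟨e⟩⟩
    -- Positivity of `m` comes from `W` being nonempty.
    obtain rfl : H = ⊤ := eq_top_iff_exists_iso.1
      ⟨m, Fin.pos (e (Classical.arbitrary W)), ⟨e⟩⟩
    rw [indComplex_lexProduct_top]
    exact h.blowup (covers_fst _)
  · exact eq_top_iff_exists_iso.2 (eq_top_of_facetConnected hG h.1 h.facetConnected)
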